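/- Let $X$ be a metric space with base point $o$ and Gromov product $(x|y)=\tfrac12\big(d(x,o)+d(y,o)-d(x,y)\big)$. Suppose that $X$ is Gromov-hyperbolic (there is $\delta\ge 0$ with $(x|z)\ge\min\{(x|y),(y|z)\}-\delta$ for all $x,y,z\in X$) and proper (closed balls are compact). For $A\subseteq X$, let $\partial A$ be the set of sequences $(x_i)$ in $A$ with $\lim_{i,j\to\infty}(x_i|x_j)=\infty$, modulo $(x_i)\sim(y_j)$ if $\lim_{i,j\to\infty}(x_i|y_j)=\infty$. For $\xi,\eta\in\partial X$ put $(\xi|\eta)=\sup\liminf_{i,j\to\infty}(x_i|y_j)$, the supremum being over the sequences $(x_i)$, $(y_j)$ that represent $\xi$ and $\eta$, and put $\beta(\xi,r)=\{\eta\in\partial X:(\xi|\eta)>-\log r\}$ for $r>0$. Give $\partial X$ the topology in which the sets $\beta(\xi,r)$, $r>0$, form a neighbourhood base of $\xi$, and suppose that $\partial X$ is compact. For $\Lambda\subseteq\partial X$ and $s\ge 0$, let $H^s(\Lambda)=\lim_{\varepsilon\to0}H^s_\varepsilon(\Lambda)$, where $H^s_\varepsilon(\Lambda)$ is the infimum of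 $\sum_{i\in\mathbb N}r_i^s$ over all coverings of $\Lambda$ by balls $\beta(\xi_i,r_i)$, $i\in\mathbb N$, with $0<r_i\le\varepsilon$. The visual dimension of $\Lambda$ is $\dim_{vis}(\Lambda)=\inf\{s\ge0:H^s(\Lambda)=0\}$. Two subsets $A,B$ of $X$ are called Gromov-disjoint if their closures in $X$ are disjoint and $\sup_{a\in A,\,b\in B}(a|b)<\infty$. A semigroup $\Gamma$ of (bijective) isometries of $X$ is called Schottky if there are a subset $X_+\subseteq X$ and a finite set $\{g_1,\dots,g_n\}$, $n\ge1$, of distinct isometries that generates $\Gamma$ as a semigroup (so $\Gamma$ is the set of nonempty products of the $g_i$), such that $g_1X_+,\dots,g_nX_+$ and $X\setminus X_+$ are pairwise Gromov-disjoint and $X_+\setminus(g_1X_+\cup\dots\cup g_nX_+)$ has nonempty interior. The limit set of $\Gamma$ is $\Lambda_\Gamma=\partial(\Gamma o)$, and its critical exponent is $$\delta_\Gamma=\limsup_{n\to\infty}\frac1n\log\#\big(B(o,n)\cap\Gamma o\big).$$ Then, for every Schottky semigroup $\Gamma$ of isometries of $X$, $$\dim_{vis}(\Lambda_\Gamma)=\delta_\Gamma.$$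 -/

import Mathlib

open Filter
open scoped NNReal ENNReal

section GromovSpace

variable {X : Type*} [MetricSpace X]

/-- The Gromov product `(x | y)` with respect to the base point `o`. -/
noncomputable def gromovProd (o x y : X) : ℝ :=
  (dist x o + dist y o - dist x y) / 2

theorem gromovProd_comm (o x y : X) : gromovProd o x y = gromovProd o y x := by
  unfold gromovProd
  rw [dist_comm x y]
  ring

variable (X) in
/-- Gromov hyperbolicity. If the inequality holds with a constant `δ` for one base point, then it
holds with the constant `2 * δ` for all base points, so that the quantification over `o`
is harmless. -/
class GromovHyperbolic : Prop where
  exists_delta : ∃ δ : ℝ, 0 ≤ δ ∧ ∀ o x y z : X,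
    min (gromovProd o x y) (gromovProd o y z) - δ ≤ gromovProd o x z

/-- Two sequences satisfy `lim_{i,j → ∞} (x i | y j) = ∞`. -/
def GromovClose (o : X) (x y : ℕ → X) : Prop :=
  Tendsto (fun p : ℕ × ℕ => gromovProd o (x p.1) (y p.2)) atTop atTop

theorem GromovClose.symm {o : X} {x y : ℕ → X} (h : GromovClose o x y) : GromovClose o y x := by
  unfold GromovClose at *
  rw [← prod_atTop_atTop_eq] at *
  exact (h.comp tendsto_prod_swap).congr fun p => gromovProd_comm _ _ _

theorem GromovClose.trans [GromovHyperbolic X] {o : X} {x y z : ℕ → X}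
    (h₁ : GromovClose o x y) (h₂ : GromovClose o y z) : GromovClose o x z := by
  obtain ⟨δ, -, hδ⟩ := GromovHyperbolic.exists_delta (X := X)
  unfold GromovClose at *
  rw [tendsto_atTop] at *
  intro b
  have e₁ := h₁ (b + δ)
  have e₂ := h₂ (b + δ)
  rw [eventually_atTop] at *
  obtain ⟨⟨i₁, j₁⟩, e₁⟩ := e₁
  obtain ⟨⟨i₂, j₂⟩, e₂⟩ := e₂
  refine ⟨(i₁, j₂), fun p hp => ?_⟩
  have f₁ := e₁ (p.1, max j₁ i₂) ⟨hp.1, le_max_left _ _⟩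
  have f₂ := e₂ (max j₁ i₂, p.2) ⟨le_max_right _ _, hp.2⟩
  have := hδ o (x p.1) (y (max j₁ i₂)) (z p.2)
  have := le_min f₁ f₂
  linarith

/-- The sequences that converge at infinity. -/
def GromovSeq (o : X) : Type _ := {x : ℕ → X // GromovClose o x x}

/-- Equivalence of sequences that converge at infinity. -/
instance gromovSetoid [GromovHyperbolic X] (o : X) : Setoid (GromovSeq o) where
  r x y := GromovClose o x.1 y.1
  iseqv := ⟨fun x => x.2, fun h => h.symm, fun h₁ h₂ => h₁.trans h₂⟩

/-- The Gromov boundary `∂X`. -/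
def GromovBoundary [GromovHyperbolic X] (o : X) : Type _ := Quotient (gromovSetoid o)

variable [GromovHyperbolic X]

/-- The boundary `∂A ⊆ ∂X` of a subset `A` of `X`: the classes of the sequences in `A` that
converge at infinity. -/
def boundaryOf (o : X) (A : Set X) : Set (GromovBoundary o) :=
  {ξ | ∃ x : GromovSeq o, (∀ i, x.1 i ∈ A) ∧ Quotient.mk (gromovSetoid o) x = ξ}

/-- The Gromov product of two boundary points: the supremum, over the sequences `x` and `y`
that represent them, of `liminf_{i,j → ∞} (x i | y j)`. -/
noncomputable def boundaryProd {o : X} (ξ η : GromovBoundary o) : EReal :=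
  ⨆ (x : GromovSeq o) (_ : Quotient.mk (gromovSetoid o) x = ξ)
    (y : GromovSeq o) (_ : Quotient.mk (gromovSetoid o) y = η),
    liminf (fun p : ℕ × ℕ => ((gromovProd o (x.1 p.1) (y.1 p.2) : ℝ) : EReal)) atTop

/-- The ball `β(ξ, r)` of `∂X`, for `r > 0`. -/
def boundaryBall {o : X} (ξ : GromovBoundary o) (r : ℝ) : Set (GromovBoundary o) :=
  {η | ((-Real.log r : ℝ) : EReal) < boundaryProd ξ η}

theorem boundaryBall_mono {o : X} (ξ : GromovBoundary o) {r r' : ℝ} (hr : 0 < r) (h : r ≤ r') :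
    boundaryBall ξ r ⊆ boundaryBall ξ r' := by
  intro η hη
  refine lt_of_le_of_lt ?_ (show ((-Real.log r : ℝ) : EReal) < boundaryProd ξ η from hη)
  exact_mod_cast neg_le_neg (Real.log_le_log hr h)

/-- The topology of `∂X` for which the balls `β(ξ, r)`, `r > 0`, are a neighbourhood base of `ξ`. -/
instance (o : X) : TopologicalSpace (GromovBoundary o) where
  IsOpen U := ∀ ξ ∈ U, ∃ r : ℝ, 0 < r ∧ boundaryBall ξ r ⊆ U
  isOpen_univ := fun _ _ => ⟨1, one_pos, Set.subset_univ _⟩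
  isOpen_inter := by
    rintro U V hU hV ξ ⟨h₁, h₂⟩
    obtain ⟨r, hr, hrU⟩ := hU ξ h₁
    obtain ⟨r', hr', hrV⟩ := hV ξ h₂
    refine ⟨min r r', lt_min hr hr', Set.subset_inter ?_ ?_⟩
    · exact (boundaryBall_mono ξ (lt_min hr hr') (min_le_left _ _)).trans hrU
    · exact (boundaryBall_mono ξ (lt_min hr hr') (min_le_right _ _)).trans hrV
  isOpen_sUnion := by
    rintro 𝒰 h ξ ⟨U, hU, hξ⟩
    obtain ⟨r, hr, hrU⟩ := h U hU ξ hξ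
    exact ⟨r, hr, hrU.trans (Set.subset_sUnion_of_mem hU)⟩

/-- `H^s_ε(Λ)`: the infimum of the sums `∑ r_i ^ s` over all coverings of `Λ` by a sequence of
balls `β(ξ_i, r_i)` of radii `r_i ≤ ε`. -/
noncomputable def visualPremeasure {o : X} (s : ℝ≥0) (ε : ℝ) (Λ : Set (GromovBoundary o)) :
    ℝ≥0∞ :=
  ⨅ (ξ : ℕ → GromovBoundary o) (r : ℕ → ℝ) (_ : ∀ i, 0 < r i ∧ r i ≤ ε)
    (_ : Λ ⊆ ⋃ i, boundaryBall (ξ i) (r i)), ∑' i, ENNReal.ofReal (r i ^ (s : ℝ))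

/-- The visual measure `H^s(Λ)` of dimension `s`: the limit of `H^s_ε(Λ)` as `ε` decreases to `0`,
which is a supremum because `H^s_ε(Λ)` is nonincreasing in `ε`. -/
noncomputable def visualMeasure {o : X} (s : ℝ≥0) (Λ : Set (GromovBoundary o)) : ℝ≥0∞ :=
  ⨆ (ε : ℝ) (_ : 0 < ε), visualPremeasure s ε Λ

/-- The visual dimension: the infimum of the real numbers `s ≥ 0` such that `H^s(Λ) = 0`. -/
noncomputable def visualDim {o : X} (Λ : Set (GromovBoundary o)) : EReal :=
  ⨅ (s : ℝ≥0) (_ : visualMeasure s Λ = 0), ((s : ℝ) : EReal)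

end GromovSpace

section Semigroups

variable {X : Type*} [MetricSpace X]

/-- The orbit `A o` of the base point `o` under a set `A` of isometries. -/
def orbitOf (o : X) (A : Set (X ≃ᵢ X)) : Set X := (fun γ : X ≃ᵢ X => γ o) '' A

/-- The critical exponent of a subset `P` of `X`:
`limsup_{n → ∞} (1 / n) * log (#(B(o, n) ∩ P))`, possibly infinite. -/
noncomputable def criticalExponent (o : X) (P : Set X) : EReal :=
  ExpGrowth.expGrowthSup (fun n : ℕ => ((Metric.ball o n ∩ P).encard : ℝ≥0∞))

/-- Gromov-disjoint subsets of `X`: their closures in `X` are disjoint and the Gromov products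
`(a | b)`, for `a ∈ A` and `b ∈ B`, are bounded above. -/
def GromovDisjoint (o : X) (A B : Set X) : Prop :=
  Disjoint (closure A) (closure B) ∧ ∃ C : ℝ, 0 < C ∧ ∀ a ∈ A, ∀ b ∈ B, gromovProd o a b < C

/-- `Γ` is a Schottky semigroup: for some subset `Y` of `X` (the domain of `Γ`), it is generated,
as a semigroup, by a nonempty finite set `S` of isometries such that the sets `g Y`, for `g ∈ S`,
and `X \ Y` are pairwise Gromov-disjoint, and such that `Y \ ⋃ g ∈ S, g Y` has nonempty
interior. -/
def IsSchottky (o : X) (Γ : Subsemigroup (X ≃ᵢ X)) : Prop :=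
  ∃ (Y : Set X) (S : Finset (X ≃ᵢ X)), S.Nonempty ∧
    Subsemigroup.closure (S : Set (X ≃ᵢ X)) = Γ ∧
    (∀ g ∈ S, ∀ h ∈ S, g ≠ h → GromovDisjoint o (g '' Y) (h '' Y)) ∧
    (∀ g ∈ S, GromovDisjoint o (g '' Y) Yᶜ) ∧
    (interior (Y \ ⋃ g ∈ S, g '' Y)).Nonempty

/-- The limit set of `Γ`: the boundary of the orbit `Γ o`. -/
def limitSet [GromovHyperbolic X] (o : X) (Γ : Subsemigroup (X ≃ᵢ X)) :
    Set (GromovBoundary o) :=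
  boundaryOf o (orbitOf o (Γ : Set (X ≃ᵢ X)))

end Semigroups

/-! ### Gromov products along words in the generators -/

section Words

variable {X : Type*} [MetricSpace X] {ι : Type*}

/-! Ping-pong makes the orbit look like a tree of words, up to bounded errors: a word nearly passes
through its prefixes, so norms are almost additive; words that diverge after `w` have Gromov product
at most the norm of `w` plus a constant; and only finitely many words have bounded norm.
`SeparatedWords` records this, and the rest uses only these properties and hyperbolicity. Both
inequalities go through the Poincaré series, with terms `exp (-s * norm)`.

Upper bound: for `s` above the critical exponent the series over the orbit converges. Every limit
point lies in the shadow of arbitrarily far orbit points `x`, a boundary ball of radius comparable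
to `exp (-dist x o)`, so tails of the series bound the sums of covers
(`visualMeasure_eq_zero_of_criticalExponent_lt`).

Lower bound: if `H^s` vanishes, take a cover with small sum. The infinite words whose limit points
lie in one ball share a prefix of norm at least `-log r`, up to a constant. Compactness of the space
of infinite words leaves finitely many prefixes, of small total weight, and every long word starts
with one of them. Since the weight is submultiplicative up to a constant, the series over all words
converges (`exists_sum_le_of_wordPrefix`), which bounds the orbit growth. No measure on the limit
set is needed. -/

theorem gromovProd_self (o x : X) : gromovProd o x x = dist x o := by
  simp [gromovProd]

theorem gromovProd_le_dist_left (o x y : X) : gromovProd o x y ≤ dist x o := by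
  have := dist_triangle y x o
  rw [dist_comm y x] at this
  unfold gromovProd
  linarith

theorem gromovProd_le_add_dist (o x y x' y' : X) :
    gromovProd o x y ≤ gromovProd o x' y' + dist x x' + dist y y' := by
  have h₁ := dist_triangle x x' o
  have h₂ := dist_triangle y y' o
  have h₃ := dist_triangle4 x' x y y'
  rw [dist_comm x' x] at h₃
  unfold gromovProd
  linarith

theorem gromovProd_map_le (o x y : X) (γ : X ≃ᵢ X) :
    gromovProd o (γ x) (γ y) ≤ dist (γ o) o + gromovProd o x y := by
  have h₁ := dist_triangle (γ x) (γ o) o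
  have h₂ := dist_triangle (γ y) (γ o) o
  rw [γ.isometry.dist_eq] at h₁ h₂
  unfold gromovProd
  rw [γ.isometry.dist_eq]
  linarith

/-- The product of the isometries along a word. -/
def wordMap (g : ι → X ≃ᵢ X) (w : List ι) : X ≃ᵢ X := (w.map g).prod

@[simp] theorem wordMap_nil (g : ι → X ≃ᵢ X) : wordMap g [] = 1 := rfl

theorem wordMap_cons (g : ι → X ≃ᵢ X) (i : ι) (w : List ι) :
    wordMap g (i :: w) = g i * wordMap g w := by
  simp [wordMap]

theorem wordMap_append (g : ι → X ≃ᵢ X) (u v : List ι) :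
    wordMap g (u ++ v) = wordMap g u * wordMap g v := by
  simp [wordMap]

/-- The distance from the base point to its image along a word. -/
noncomputable def wordNorm (o : X) (g : ι → X ≃ᵢ X) (w : List ι) : ℝ :=
  dist (wordMap g w o) o

@[simp] theorem wordNorm_nil (o : X) (g : ι → X ≃ᵢ X) : wordNorm o g [] = 0 := by
  simp [wordNorm]

/-- Moving by the inverse of the prefix turns a product seen from its orbit point into one seen from
`o`; this is how `prod_inv_le` makes a word pass near its prefixes. -/
theorem gromovProd_wordMap_append (o : X) (g : ι → X ≃ᵢ X) (u v : List ι) :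
    gromovProd o (wordMap g (u ++ v) o) (wordMap g u o) =
      wordNorm o g u - gromovProd o ((wordMap g u)⁻¹ o) (wordMap g v o) := by
  have h₁ : dist ((wordMap g u)⁻¹ o) o = dist (wordMap g u o) o := by
    rw [← (wordMap g u).isometry.dist_eq, IsometryEquiv.apply_inv_self, dist_comm]
  have h₂ : dist ((wordMap g u)⁻¹ o) (wordMap g v o) = dist (wordMap g (u ++ v) o) o := by
    rw [← (wordMap g u).isometry.dist_eq, IsometryEquiv.apply_inv_self, wordMap_append,
      IsometryEquiv.mul_apply, dist_comm]
  unfold gromovProd wordNorm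
  rw [h₁, h₂, wordMap_append, IsometryEquiv.mul_apply, (wordMap g u).isometry.dist_eq]
  ring

/-- The metric properties of the words in the generators of a Schottky semigroup. -/
structure SeparatedWords (o : X) (g : ι → X ≃ᵢ X) (C : ℝ) : Prop where
  nonneg : 0 ≤ C
  prod_inv_le : ∀ u v, gromovProd o ((wordMap g u)⁻¹ o) (wordMap g v o) ≤ C
  prod_cons_le : ∀ i j u v, i ≠ j →
    gromovProd o (wordMap g (i :: u) o) (wordMap g (j :: v) o) ≤ C
  finite : ∀ R, {w | wordNorm o g w ≤ R}.Finite

namespace SeparatedWords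

variable {o : X} {g : ι → X ≃ᵢ X} {C : ℝ}

theorem le_prod_append (h : SeparatedWords o g C) (u v : List ι) :
    wordNorm o g u - C ≤ gromovProd o (wordMap g (u ++ v) o) (wordMap g u o) := by
  have := h.prod_inv_le u v
  rw [gromovProd_wordMap_append]
  linarith

theorem le_wordNorm_append (h : SeparatedWords o g C) (u v : List ι) :
    wordNorm o g u + wordNorm o g v - 2 * C ≤ wordNorm o g (u ++ v) := by
  have := h.le_prod_append u v
  unfold gromovProd at this
  rw [wordMap_append, IsometryEquiv.mul_apply, (wordMap g u).isometry.dist_eq] at this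
  unfold wordNorm at *
  rw [wordMap_append, IsometryEquiv.mul_apply]
  linarith

theorem prod_append_cons_le (h : SeparatedWords o g C) (w : List ι) {i j : ι} (hij : i ≠ j)
    (u v : List ι) :
    gromovProd o (wordMap g (w ++ i :: u) o) (wordMap g (w ++ j :: v) o) ≤
      wordNorm o g w + C := by
  have := h.prod_cons_le i j u v hij
  rw [wordMap_append, wordMap_append, IsometryEquiv.mul_apply, IsometryEquiv.mul_apply]
  exact (gromovProd_map_le o _ _ _).trans (by unfold wordNorm; linarith)

theorem exists_length_le (h : SeparatedWords o g C) (R : ℝ) :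
    ∃ n : ℕ, ∀ w : List ι, n ≤ w.length → R < wordNorm o g w := by
  obtain ⟨n, hn⟩ := ((h.finite R).image List.length).bddAbove
  refine ⟨n + 1, fun w hw => ?_⟩
  by_contra! hlt
  have := hn ⟨w, hlt, rfl⟩
  omega

end SeparatedWords

theorem finite_of_pairwise_le_dist [ProperSpace X] {κ : Type*} {f : κ → X} {r : ℝ} (hr : 0 < r)
    {A : Set κ} (hA : ∀ a ∈ A, ∀ b ∈ A, a ≠ b → r ≤ dist (f a) (f b))
    (hb : Bornology.IsBounded (f '' A)) : A.Finite := by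
  rcases A.eq_empty_or_nonempty with rfl | ⟨a₀, -⟩
  · exact Set.finite_empty
  have : Nonempty X := ⟨f a₀⟩
  have htb : TotallyBounded (f '' A) := hb.isCompact_closure.totallyBounded.subset subset_closure
  obtain ⟨t, ht, hcov⟩ := Metric.totallyBounded_iff.1 htb (r / 2) (half_pos hr)
  have hsub : ∀ a ∈ A, ∃ y ∈ t, dist (f a) y < r / 2 := fun a ha => by
    simpa using hcov ⟨a, ha, rfl⟩
  choose! c hc hd using hsub
  refine Set.Finite.of_finite_image (f := c) (ht.subset ?_) ?_
  · rintro _ ⟨a, ha, rfl⟩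
    exact hc a ha
  · intro a ha b hb hab
    by_contra hne
    have h₁ := hd a ha
    have h₂ := hd b hb
    rw [← hab] at h₂
    have := dist_triangle_right (f a) (f b) (c a)
    linarith [hA a ha b hb hne]

end Words

/-! ### Ping-pong: Schottky semigroups have separated words -/

section Schottky

variable {X : Type*} [MetricSpace X] {ι : Type*}

theorem mapsTo_wordMap {g : ι → X ≃ᵢ X} {Y : Set X} (hg : ∀ i, g i '' Y ⊆ Y) (w : List ι) {x : X}
    (hx : x ∈ Y) : wordMap g w x ∈ Y := by
  induction w with
  | nil => simpa
  | cons i w ih =>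
    rw [wordMap_cons]
    exact hg i ⟨_, ih, rfl⟩

/-- Ping-pong with room around `p`: cancel common first letters. If one word runs out, the ball
around `p` avoids every `g i '' Y`. If the first letters differ, a closer point would pull back into
the ball, hence into `Y`, and so lie in two disjoint images. -/
theorem le_dist_wordMap {g : ι → X ≃ᵢ X} {Y : Set X} {p : X} {r : ℝ}
    (hg : ∀ i, g i '' Y ⊆ Y) (hdisj : ∀ i j, i ≠ j → Disjoint (g i '' Y) (g j '' Y))
    (hp : p ∈ Y) (hball : Metric.ball p r ⊆ Y) (hball' : ∀ i, Disjoint (Metric.ball p r) (g i '' Y))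
    {u v : List ι} (huv : u ≠ v) : r ≤ dist (wordMap g u p) (wordMap g v p) := by
  have hnil : ∀ i w, r ≤ dist p (wordMap g (i :: w) p) := fun i w => by
    by_contra! hlt
    refine (hball' i).notMem_of_mem_left (a := wordMap g (i :: w) p) ?_
      ⟨wordMap g w p, mapsTo_wordMap hg w hp, by rw [wordMap_cons]; rfl⟩
    rwa [Metric.mem_ball, dist_comm]
  induction u generalizing v with
  | nil =>
    cases v with
    | nil => exact absurd rfl huv
    | cons j v => simpa using hnil j v
  | cons i u ih =>
    cases v with
    | nil => simpa [dist_comm] using hnil i u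
    | cons j v =>
      by_cases hij : i = j
      · subst hij
        rw [wordMap_cons, wordMap_cons, IsometryEquiv.mul_apply, IsometryEquiv.mul_apply,
          (g i).isometry.dist_eq]
        exact ih fun h => huv (by rw [h])
      · by_contra! hlt
        set γ := wordMap g (i :: u) with hγ
        set x := wordMap g (j :: v) p with hx
        have hball₂ : γ⁻¹ x ∈ Metric.ball p r := by
          rw [Metric.mem_ball, ← γ.isometry.dist_eq, IsometryEquiv.apply_inv_self, dist_comm]
          exact hlt
        refine (hdisj i j hij).notMem_of_mem_left (a := x)
          ⟨wordMap g u (γ⁻¹ x), mapsTo_wordMap hg u (hball hball₂), ?_⟩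
          ⟨wordMap g v p, mapsTo_wordMap hg v hp, ?_⟩
        · rw [← IsometryEquiv.mul_apply, ← wordMap_cons, ← hγ, IsometryEquiv.apply_inv_self]
        · rw [← IsometryEquiv.mul_apply, ← wordMap_cons]

theorem Subsemigroup.coe_closure_range_eq {G : Type*} [Monoid G] (g : ι → G) :
    (Subsemigroup.closure (Set.range g) : Set G) =
      {γ | ∃ w : List ι, w ≠ [] ∧ (w.map g).prod = γ} := by
  ext γ
  constructor
  · intro h
    induction h using Subsemigroup.closure_induction with
    | mem x hx =>
      obtain ⟨i, rfl⟩ := hx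
      exact ⟨[i], by simp, by simp⟩
    | mul x y _ _ hx hy =>
      obtain ⟨u, hu, rfl⟩ := hx
      obtain ⟨v, -, rfl⟩ := hy
      exact ⟨u ++ v, by simp [hu], by simp⟩
  · rintro ⟨w, hw, rfl⟩
    induction w with
    | nil => exact absurd rfl hw
    | cons i w ih =>
      have hi : g i ∈ Subsemigroup.closure (Set.range g) := Subsemigroup.subset_closure ⟨i, rfl⟩
      by_cases h : w = []
      · simpa [h] using hi
      · simpa using Subsemigroup.mul_mem _ hi (ih h)

/-- Nonempty words send an interior point `p` of the gap into the image of `Y` under their first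
letter, and inverses of words keep a point `q` outside `Y` there. Gromov-disjointness thus bounds
the products for `p` and `q`; replacing these points by `o` costs at most `2 * D`. Finiteness comes
from properness, as the images of `p` are uniformly separated. -/
theorem IsSchottky.exists_separatedWords [ProperSpace X] {o : X} {Γ : Subsemigroup (X ≃ᵢ X)}
    (hΓ : IsSchottky o Γ) :
    ∃ (S : Finset (X ≃ᵢ X)) (C : ℝ), S.Nonempty ∧
      orbitOf o (Γ : Set (X ≃ᵢ X)) =
        {x | ∃ w : List S, w ≠ [] ∧ wordMap (fun γ : S => (γ : X ≃ᵢ X)) w o = x} ∧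
      SeparatedWords o (fun γ : S => (γ : X ≃ᵢ X)) C := by
  obtain ⟨Y, S, hS, hgen, hST, hSY, hint⟩ := hΓ
  set g : S → X ≃ᵢ X := fun γ => (γ : X ≃ᵢ X) with hg
  have hrange : (S : Set (X ≃ᵢ X)) = Set.range g := by simp [hg]
  obtain ⟨p, hp⟩ := hint
  obtain ⟨r, hr, hball⟩ := Metric.isOpen_iff.1 isOpen_interior p hp
  replace hball := hball.trans interior_subset
  have hpY : p ∈ Y := (interior_subset hp).1
  obtain ⟨γ₀, hγ₀⟩ := hS
  -- Were `Y` everything, a single generator would already cover it and leave no gap.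
  obtain ⟨q, hq⟩ : Yᶜ.Nonempty := by
    by_contra! h
    have hY : Y = Set.univ := Set.compl_empty_iff.1 h
    refine (interior_subset hp).2 (Set.mem_biUnion hγ₀ ?_)
    rw [hY, Set.image_univ, γ₀.surjective.range_eq]
    trivial
  have hsub : ∀ i, g i '' Y ⊆ Y := fun i x hx => by
    by_contra h
    exact Set.disjoint_left.1 (hSY _ i.2).1 (subset_closure hx) (subset_closure h)
  have hdisj : ∀ i j, i ≠ j → Disjoint (g i '' Y) (g j '' Y) := fun i j hij =>
    (hST _ i.2 _ j.2 fun h => hij (Subtype.ext h)).1.mono subset_closure subset_closure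
  obtain ⟨C₁, hC₁⟩ : ∃ C₁ : ℝ, ∀ i : S, ∀ a ∈ g i '' Y, ∀ b ∈ Yᶜ, gromovProd o a b ≤ C₁ := by
    choose c hc using fun i : S => (hSY _ i.2).2
    obtain ⟨M, hM⟩ := (Set.finite_range c).bddAbove
    exact ⟨M, fun i a ha b hb => ((hc i).2 a ha b hb).le.trans (hM ⟨i, rfl⟩)⟩
  obtain ⟨C₂, hC₂⟩ : ∃ C₂ : ℝ, ∀ i j : S, i ≠ j → ∀ a ∈ g i '' Y, ∀ b ∈ g j '' Y,
      gromovProd o a b ≤ C₂ := by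
    have h : ∀ k : S × S, ∃ c : ℝ, k.1 ≠ k.2 → ∀ a ∈ g k.1 '' Y, ∀ b ∈ g k.2 '' Y,
        gromovProd o a b ≤ c := fun k => by
      by_cases hk : k.1 = k.2
      · exact ⟨0, fun h => absurd hk h⟩
      · obtain ⟨c, -, hc⟩ := (hST _ k.1.2 _ k.2.2 fun h => hk (Subtype.ext h)).2
        exact ⟨c, fun _ a ha b hb => (hc a ha b hb).le⟩
    choose c hc using h
    obtain ⟨M, hM⟩ := (Set.finite_range c).bddAbove
    exact ⟨M, fun i j hij a ha b hb => (hc (i, j) hij a ha b hb).trans (hM ⟨(i, j), rfl⟩)⟩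
  set D := dist o p + dist o q with hD
  refine ⟨S, max 0 (max C₁ C₂) + 2 * D, ⟨γ₀, hγ₀⟩, ?_, ?_⟩
  · ext x
    rw [orbitOf, ← hgen, hrange, Subsemigroup.coe_closure_range_eq]
    constructor
    · rintro ⟨_, ⟨w, hw, rfl⟩, rfl⟩
      exact ⟨w, hw, rfl⟩
    · rintro ⟨w, hw, rfl⟩
      exact ⟨_, ⟨w, hw, rfl⟩, rfl⟩
  have hop : 0 ≤ dist o p := dist_nonneg
  have hoq : 0 ≤ dist o q := dist_nonneg
  have hC₁' := (le_max_left C₁ C₂).trans (le_max_right 0 _)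
  have hC₂' := (le_max_right C₁ C₂).trans (le_max_right 0 _)
  have hC₀ := le_max_left 0 (max C₁ C₂)
  have hmem : ∀ i w, wordMap g (i :: w) p ∈ g i '' Y := fun i w =>
    ⟨wordMap g w p, mapsTo_wordMap hsub w hpY, by rw [wordMap_cons]; rfl⟩
  refine ⟨by linarith, fun u v => ?_, fun i j u v hij => ?_, fun R => ?_⟩
  · cases v with
    | nil =>
      rw [gromovProd_comm]
      refine (gromovProd_le_dist_left _ _ _).trans ?_
      simp only [wordMap_nil, IsometryEquiv.coe_one, id, dist_self]
      linarith
    | cons i v =>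
      have hq' : (wordMap g u)⁻¹ q ∈ Yᶜ := fun h => hq <| by
        simpa using mapsTo_wordMap hsub u h
      have h₁ := hC₁ i _ (hmem i v) _ hq'
      have h₂ := gromovProd_le_add_dist o (wordMap g (i :: v) o) ((wordMap g u)⁻¹ o)
        (wordMap g (i :: v) p) ((wordMap g u)⁻¹ q)
      rw [IsometryEquiv.dist_eq, IsometryEquiv.dist_eq] at h₂
      rw [gromovProd_comm]
      linarith
  · have h₁ := hC₂ i j hij _ (hmem i u) _ (hmem j v)
    have h₂ := gromovProd_le_add_dist o (wordMap g (i :: u) o) (wordMap g (j :: v) o)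
      (wordMap g (i :: u) p) (wordMap g (j :: v) p)
    rw [IsometryEquiv.dist_eq, IsometryEquiv.dist_eq] at h₂
    linarith
  · refine finite_of_pairwise_le_dist (f := fun w => wordMap g w p) hr (fun u _ v _ huv => ?_) ?_
    · refine le_dist_wordMap hsub hdisj hpY (fun x hx => (hball hx).1) (fun i => ?_) huv
      refine Set.disjoint_left.2 fun x hx hxi => (hball hx).2 (Set.mem_biUnion i.2 hxi)
    · refine Metric.isBounded_closedBall (x := o) (r := R + dist o p) |>.subset ?_
      rintro _ ⟨w, hw, rfl⟩
      have h₁ := dist_triangle (wordMap g w p) (wordMap g w o) o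
      rw [IsometryEquiv.dist_eq, dist_comm p o] at h₁
      have h₂ : dist (wordMap g w o) o ≤ R := hw
      simp only [Metric.mem_closedBall]
      linarith

end Schottky

/-! ### Boundary products and representatives -/

section Boundary

variable {X : Type*} [MetricSpace X] {o : X} {δ : ℝ}

theorem gromovClose_iff {x y : ℕ → X} :
    GromovClose o x y ↔ ∀ b : ℝ, ∃ k, ∀ i j, k ≤ i → k ≤ j → b ≤ gromovProd o (x i) (y j) := by
  simp only [GromovClose, tendsto_atTop, eventually_atTop_prod_self]

theorem le_gromovProd_of_le_of_le (hδ : ∀ x y z : X,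
      min (gromovProd o x y) (gromovProd o y z) - δ ≤ gromovProd o x z)
    {x y z : X} {a : ℝ} (h₁ : a ≤ gromovProd o x y) (h₂ : a ≤ gromovProd o y z) :
    a - δ ≤ gromovProd o x z := by
  have := hδ x y z
  have := le_min h₁ h₂
  linarith

variable [GromovHyperbolic X]

theorem le_boundaryProd (x y : GromovSeq o) {a : ℝ} {k : ℕ}
    (h : ∀ i j, k ≤ i → k ≤ j → a ≤ gromovProd o (x.1 i) (y.1 j)) :
    (a : EReal) ≤ boundaryProd (Quotient.mk (gromovSetoid o) x)
      (Quotient.mk (gromovSetoid o) y) := by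
  refine le_trans ?_ (le_iSup₂_of_le x rfl (le_iSup₂_of_le y rfl le_rfl))
  refine le_liminf_of_le (by isBoundedDefault) ?_
  exact eventually_atTop_prod_self.2 ⟨k, fun i j hi hj => by exact_mod_cast h i j hi hj⟩

/-- The supremum is nearly attained by some representatives; the chain from `x` to `x'`, `y'` and
`y` passes to the given ones with two uses of hyperbolicity, whence `2 * δ`. -/
theorem eventually_le_of_lt_boundaryProd (hδ : ∀ x y z : X,
      min (gromovProd o x y) (gromovProd o y z) - δ ≤ gromovProd o x z)
    {x y : GromovSeq o} {t : ℝ} (h : (t : EReal) < boundaryProd (Quotient.mk (gromovSetoid o) x)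
      (Quotient.mk (gromovSetoid o) y)) :
    ∃ k, ∀ i j, k ≤ i → k ≤ j → t - 2 * δ ≤ gromovProd o (x.1 i) (y.1 j) := by
  simp only [boundaryProd, lt_iSup_iff] at h
  obtain ⟨x', hx', y', hy', h⟩ := h
  obtain ⟨k₁, h₁⟩ := eventually_atTop_prod_self.1 (eventually_lt_of_lt_liminf h)
  obtain ⟨k₂, h₂⟩ := gromovClose_iff.1 (Quotient.exact hx' : GromovClose o x'.1 x.1) t
  obtain ⟨k₃, h₃⟩ := gromovClose_iff.1 (Quotient.exact hy' : GromovClose o y'.1 y.1) (t - δ)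
  refine ⟨max k₂ k₃, fun i j hi hj => ?_⟩
  have e₁ := h₁ (max k₁ k₂) (max k₁ k₃) (le_max_left _ _) (le_max_left _ _)
  have e₁' : t ≤ gromovProd o (x'.1 (max k₁ k₂)) (y'.1 (max k₁ k₃)) := by
    exact_mod_cast e₁.le
  have e₂ := h₂ (max k₁ k₂) i (le_max_right _ _) ((le_max_left _ _).trans hi)
  have e₃ := h₃ (max k₁ k₃) j (le_max_right _ _) ((le_max_right _ _).trans hj)
  rw [gromovProd_comm] at e₂
  have := le_gromovProd_of_le_of_le hδ (le_gromovProd_of_le_of_le hδ e₂ e₁') e₃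
  linarith

end Boundary

/-! ### Infinite words, compactness and summable weights -/

section InfiniteWords

variable {ι : Type*}

/-- The prefix of length `n` of an infinite word. -/
def wordPrefix (u : ℕ → ι) (n : ℕ) : List ι := (List.range n).map u

@[simp] theorem length_wordPrefix (u : ℕ → ι) (n : ℕ) : (wordPrefix u n).length = n := by
  simp [wordPrefix]

theorem wordPrefix_succ (u : ℕ → ι) (n : ℕ) : wordPrefix u (n + 1) = wordPrefix u n ++ [u n] := by
  simp [wordPrefix, List.range_succ]

theorem wordPrefix_add (u : ℕ → ι) (m n : ℕ) :
    wordPrefix u (m + n) = wordPrefix u m ++ wordPrefix (fun k => u (m + k)) n := by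
  simp [wordPrefix, List.range_add, Function.comp_def]

theorem exists_wordPrefix_eq_append (u : ℕ → ι) {m n : ℕ} (h : m ≤ n) :
    ∃ v, wordPrefix u n = wordPrefix u m ++ v := by
  obtain ⟨k, rfl⟩ := Nat.exists_eq_add_of_le h
  exact ⟨_, wordPrefix_add u m k⟩

theorem exists_wordPrefix_eq_append_cons (u : ℕ → ι) {m n : ℕ} (h : m < n) :
    ∃ v, wordPrefix u n = wordPrefix u m ++ u m :: v := by
  obtain ⟨v, hv⟩ := exists_wordPrefix_eq_append u (Nat.succ_le_of_lt h)
  exact ⟨v, by rw [hv, Nat.succ_eq_add_one, wordPrefix_succ, List.append_assoc]; rfl⟩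

theorem exists_wordPrefix_eq_of_ne {u v : ℕ → ι} {n : ℕ} (h : wordPrefix u n ≠ wordPrefix v n) :
    ∃ m < n, wordPrefix u m = wordPrefix v m ∧ u m ≠ v m := by
  induction n with
  | zero => exact absurd rfl h
  | succ n ih =>
    by_cases hn : wordPrefix u n = wordPrefix v n
    · refine ⟨n, Nat.lt_succ_self n, hn, fun huv => h ?_⟩
      rw [wordPrefix_succ, wordPrefix_succ, hn, huv]
    · obtain ⟨m, hm, h'⟩ := ih hn
      exact ⟨m, hm.trans (Nat.lt_succ_self n), h'⟩

theorem exists_infinite_word [Nonempty ι] (w : List ι) : ∃ u : ℕ → ι, wordPrefix u w.length = w := by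
  obtain ⟨i⟩ := ‹Nonempty ι›
  refine ⟨fun n => w.getD n i, List.ext_getElem (by simp) fun n h₁ h₂ => ?_⟩
  simp [wordPrefix, h₂]

/-- Cylinders are open in the product of discrete finite alphabets, which is compact. -/
theorem exists_finite_subcover_wordPrefix [Finite ι] {κ : Type*} {I : Set κ} {w : κ → List ι}
    (h : ∀ u : ℕ → ι, ∃ k ∈ I, wordPrefix u (w k).length = w k) :
    ∃ J : Finset κ, (∀ k ∈ J, k ∈ I) ∧ ∀ u : ℕ → ι, ∃ k ∈ J, wordPrefix u (w k).length = w k := by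
  let _ : TopologicalSpace ι := ⊥
  have : DiscreteTopology ι := ⟨rfl⟩
  have hopen : ∀ k : I, IsOpen {u : ℕ → ι | wordPrefix u (w k).length = w k} := fun k => by
    have hc : Continuous fun u : ℕ → ι => fun n : Fin (w k).length => u n :=
      continuous_pi fun n => continuous_apply _
    have : {u : ℕ → ι | wordPrefix u (w k).length = w k} =
        (fun u : ℕ → ι => fun n : Fin (w k).length => u n) ⁻¹' {f | List.ofFn f = w k} := by
      ext u
      have : wordPrefix u (w k).length = List.ofFn fun n : Fin (w k).length => u n :=
        List.ext_getElem (by simp) fun n h₁ h₂ => by simp [wordPrefix]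
      simp only [Set.mem_ofPred_eq, Set.mem_preimage, this]
    rw [this]
    exact (isOpen_discrete _).preimage hc
  obtain ⟨t, ht⟩ := isCompact_univ.elim_finite_subcover _ hopen fun u _ => by
    obtain ⟨k, hk, hu⟩ := h u
    exact Set.mem_iUnion.2 ⟨⟨k, hk⟩, hu⟩
  classical
  refine ⟨t.image Subtype.val, fun k hk => ?_, fun u => ?_⟩
  · obtain ⟨k', -, rfl⟩ := Finset.mem_image.1 hk
    exact k'.2
  · obtain ⟨k, hk, hu⟩ := Set.mem_iUnion₂.1 (ht (Set.mem_univ u))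
    exact ⟨k, Finset.mem_image_of_mem _ hk, hu⟩

/-- A submultiplicative weight on words is summable if the words are generated, up to bounded
remainders, by a finite set of words of small total weight. -/
theorem exists_sum_le_of_wordPrefix [Finite ι] [Nonempty ι] {f : List ι → ℝ} (hf : ∀ w, 0 ≤ f w)
    {K θ : ℝ} (hmul : ∀ u v, f (u ++ v) ≤ K * (f u * f v)) {F : Finset (List ι)}
    (hnil : [] ∉ F) (hF : ∀ u : ℕ → ι, ∃ w ∈ F, wordPrefix u w.length = w)
    (hθ : K * ∑ w ∈ F, f w ≤ θ) (hθ₁ : θ < 1) :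
    ∃ B : ℝ, ∀ T : Finset (List ι), ∑ w ∈ T, f w ≤ B := by
  classical
  set N := F.sup List.length with hN
  set A : ℕ → Finset (List ι) := fun m => (List.finite_length_le ι m).toFinset with hA
  have memA : ∀ m w, w ∈ A m ↔ w.length ≤ m := fun m w => by simp [hA]
  set Z : ℕ → ℝ := fun m => ∑ w ∈ A m, f w with hZ
  have hZ₀ : ∀ m, 0 ≤ Z m := fun m => Finset.sum_nonneg fun w _ => hf w
  have hZmono : Monotone Z := fun m n hmn =>
    Finset.sum_le_sum_of_subset_of_nonneg
      (fun w hw => (memA _ _).2 (((memA _ _).1 hw).trans hmn)) fun w _ _ => hf w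
  -- A word longer than `N` starts with a word of `F`; that word is nonempty, so the remainder has
  -- length at most `m`.
  have hstep : ∀ m, Z (m + 1) ≤ Z N + θ * Z m := fun m => by
    have hsub : A (m + 1) ⊆ A N ∪ (F ×ˢ A m).image fun p => p.1 ++ p.2 := fun w hw => by
      by_cases hwN : w.length ≤ N
      · exact Finset.mem_union_left _ ((memA _ _).2 hwN)
      · obtain ⟨u, hu⟩ := exists_infinite_word w
        obtain ⟨a, ha, hua⟩ := hF u
        have hle : a.length ≤ w.length :=
          (Finset.le_sup (f := List.length) ha).trans (not_le.1 hwN).le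
        obtain ⟨b, hb⟩ := exists_wordPrefix_eq_append u hle
        rw [hu, hua] at hb
        refine Finset.mem_union_right _ (Finset.mem_image.2 ⟨(a, b), ?_, hb.symm⟩)
        refine Finset.mem_product.2 ⟨ha, (memA _ _).2 (show b.length ≤ m from ?_)⟩
        have h₁ := (memA _ _).1 hw
        have h₂ : a.length ≠ 0 := fun h => hnil (List.length_eq_zero_iff.1 h ▸ ha)
        rw [hb, List.length_append] at h₁
        omega
    have himage : ∑ w ∈ (F ×ˢ A m).image (fun p => p.1 ++ p.2), f w ≤
        ∑ p ∈ F ×ˢ A m, f (p.1 ++ p.2) :=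
      Finset.sum_image_le_of_nonneg fun p _ => hf _
    have hprod : ∑ p ∈ F ×ˢ A m, f (p.1 ++ p.2) ≤ (K * ∑ w ∈ F, f w) * Z m := by
      rw [mul_assoc, Finset.sum_mul_sum, ← Finset.sum_product', Finset.mul_sum]
      exact Finset.sum_le_sum fun p _ => hmul _ _
    calc Z (m + 1) ≤ ∑ w ∈ A N ∪ (F ×ˢ A m).image fun p => p.1 ++ p.2, f w :=
          Finset.sum_le_sum_of_subset_of_nonneg hsub fun w _ _ => hf w
      _ ≤ Z N + ∑ w ∈ (F ×ˢ A m).image (fun p => p.1 ++ p.2), f w := by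
          rw [← Finset.sum_union_inter]
          exact le_add_of_nonneg_right (Finset.sum_nonneg fun w _ => hf w)
      _ ≤ Z N + θ * Z m := by
          have := mul_le_mul_of_nonneg_right hθ (hZ₀ m)
          linarith
  refine ⟨Z N / (1 - θ), fun T => ?_⟩
  have hT : T ⊆ A (T.sup List.length) := fun w hw =>
    (memA _ _).2 (Finset.le_sup (f := List.length) hw)
  refine (Finset.sum_le_sum_of_subset_of_nonneg hT fun w _ _ => hf w).trans ?_
  rw [le_div_iff₀ (by linarith)]
  have := hstep (T.sup List.length)
  have := hZmono (Nat.le_succ (T.sup List.length))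
  change Z _ * _ ≤ _
  simp only [Nat.succ_eq_add_one] at this
  nlinarith

end InfiniteWords

/-! ### Limit points of infinite words -/

section LimitPoints

variable {X : Type*} [MetricSpace X] {ι : Type*} {o : X} {g : ι → X ≃ᵢ X} {C δ : ℝ}

namespace SeparatedWords

theorem exists_lt_wordNorm_wordPrefix (h : SeparatedWords o g C) (u : ℕ → ι) (R : ℝ) :
    ∃ n, R < wordNorm o g (wordPrefix u n) := by
  obtain ⟨n, hn⟩ := h.exists_length_le R
  exact ⟨n, hn _ (by simp)⟩

theorem le_prod_append_append (h : SeparatedWords o g C) (hδ : ∀ x y z : X,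
      min (gromovProd o x y) (gromovProd o y z) - δ ≤ gromovProd o x z) (w u v : List ι) :
    wordNorm o g w - C - δ ≤
      gromovProd o (wordMap g (w ++ u) o) (wordMap g (w ++ v) o) := by
  refine le_gromovProd_of_le_of_le hδ (h.le_prod_append w u) ?_
  rw [gromovProd_comm]
  exact h.le_prod_append w v

theorem gromovClose_wordPrefix (h : SeparatedWords o g C) (hδ : ∀ x y z : X,
      min (gromovProd o x y) (gromovProd o y z) - δ ≤ gromovProd o x z) (u : ℕ → ι) :
    GromovClose o (fun n => wordMap g (wordPrefix u (n + 1)) o)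
      (fun n => wordMap g (wordPrefix u (n + 1)) o) := by
  refine gromovClose_iff.2 fun b => ?_
  obtain ⟨k, hk⟩ := h.exists_lt_wordNorm_wordPrefix u (b + C + δ)
  refine ⟨k, fun i j hi hj => ?_⟩
  obtain ⟨v, hv⟩ := exists_wordPrefix_eq_append u (hi.trans i.le_succ)
  obtain ⟨v', hv'⟩ := exists_wordPrefix_eq_append u (hj.trans j.le_succ)
  have := h.le_prod_append_append hδ (wordPrefix u k) v v'
  simp only [← Nat.succ_eq_add_one, hv, hv']
  linarith

/-- The sequence of orbit points along an infinite word. -/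
def wordSeq [GromovHyperbolic X] (h : SeparatedWords o g C) (u : ℕ → ι) : GromovSeq o :=
  -- The shift by one leaves out the empty word, since `o` itself need not be in the orbit of the
  -- semigroup.
  ⟨fun n => wordMap g (wordPrefix u (n + 1)) o, by
    obtain ⟨δ, -, hδ⟩ := GromovHyperbolic.exists_delta (X := X)
    exact h.gromovClose_wordPrefix (hδ o) u⟩

/-- The limit point of an infinite word. -/
def limitPoint [GromovHyperbolic X] (h : SeparatedWords o g C) (u : ℕ → ι) : GromovBoundary o :=
  Quotient.mk (gromovSetoid o) (h.wordSeq u)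

variable [GromovHyperbolic X]

theorem limitPoint_mem (h : SeparatedWords o g C) (u : ℕ → ι) :
    h.limitPoint u ∈ boundaryOf o {x | ∃ w : List ι, w ≠ [] ∧ wordMap g w o = x} := by
  refine ⟨h.wordSeq u, fun n => ⟨wordPrefix u (n + 1), fun h => ?_, rfl⟩, rfl⟩
  simpa using congrArg List.length h

/-- Two limit points in one ball have representatives with product at least `-log r - 3 * δ`,
whereas divergence after a prefix of smaller norm caps it at that norm plus `C`. -/
theorem wordPrefix_eq_of_mem_boundaryBall (h : SeparatedWords o g C) (hδ : ∀ x y z : X,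
      min (gromovProd o x y) (gromovProd o y z) - δ ≤ gromovProd o x z) {ζ : GromovBoundary o}
    {r : ℝ} {u v : ℕ → ι} (hu : h.limitPoint u ∈ boundaryBall ζ r)
    (hv : h.limitPoint v ∈ boundaryBall ζ r) {n : ℕ}
    (hn : ∀ m < n, wordNorm o g (wordPrefix u m) < -Real.log r - C - 3 * δ) :
    wordPrefix v n = wordPrefix u n := by
  by_contra hne
  obtain ⟨m, hm, hpre, hum⟩ := exists_wordPrefix_eq_of_ne (Ne.symm hne)
  obtain ⟨z, rfl⟩ := Quotient.exists_rep ζ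
  obtain ⟨k₁, h₁⟩ := eventually_le_of_lt_boundaryProd hδ hu
  obtain ⟨k₂, h₂⟩ := eventually_le_of_lt_boundaryProd hδ hv
  set i := max m (max k₁ k₂) with hi
  have him : m < i + 1 := Nat.lt_succ_of_le (le_max_left _ _)
  have hi₁ : k₁ ≤ i := (le_max_left _ _).trans (le_max_right _ _)
  have hi₂ : k₂ ≤ i := (le_max_right _ _).trans (le_max_right _ _)
  have e₁ := h₁ i i hi₁ hi₁
  have e₂ := h₂ i i hi₂ hi₂
  rw [gromovProd_comm] at e₁
  have e₃ : _ ≤ gromovProd o (wordMap g (wordPrefix u (i + 1)) o)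
    (wordMap g (wordPrefix v (i + 1)) o) := le_gromovProd_of_le_of_le hδ e₁ e₂
  obtain ⟨a, ha⟩ := exists_wordPrefix_eq_append_cons u him
  obtain ⟨b, hb⟩ := exists_wordPrefix_eq_append_cons v him
  rw [ha, hb, ← hpre] at e₃
  have e₄ := h.prod_append_cons_le (wordPrefix u m) hum a b
  have e₅ := hn m hm
  linarith

theorem exists_word_of_boundaryBall (h : SeparatedWords o g C) (hδ : ∀ x y z : X,
      min (gromovProd o x y) (gromovProd o y z) - δ ≤ gromovProd o x z) (ζ : GromovBoundary o)
    (r : ℝ) : ∃ w : List ι, ∀ u, h.limitPoint u ∈ boundaryBall ζ r →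
      -Real.log r - C - 3 * δ ≤ wordNorm o g w ∧ wordPrefix u w.length = w := by
  classical
  by_cases hex : ∃ u, h.limitPoint u ∈ boundaryBall ζ r
  · obtain ⟨u, hu⟩ := hex
    have hR := h.exists_lt_wordNorm_wordPrefix u (-Real.log r - C - 3 * δ)
    have hR' : ∃ n, -Real.log r - C - 3 * δ ≤ wordNorm o g (wordPrefix u n) :=
      hR.imp fun n => le_of_lt
    -- The shortest prefix past the threshold: its proper prefixes are below it, which forces
    -- agreement.
    refine ⟨wordPrefix u (Nat.find hR'), fun v hv => ⟨Nat.find_spec hR', ?_⟩⟩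
    rw [length_wordPrefix]
    exact h.wordPrefix_eq_of_mem_boundaryBall hδ hu hv fun m hm => not_le.1 (Nat.find_min hR' hm)
  · exact ⟨[], fun u hu => absurd ⟨u, hu⟩ hex⟩

end SeparatedWords

end LimitPoints

/-! ### Critical exponent and Poincaré series -/

section CriticalExponent

variable {X : Type*} [MetricSpace X] {ι : Type*} {o : X} {g : ι → X ≃ᵢ X} {C δ : ℝ}

/-- The orbit of the base point under the nonempty words. -/
def wordOrbit (o : X) (g : ι → X ≃ᵢ X) : Set X := {x | ∃ w : List ι, w ≠ [] ∧ wordMap g w o = x}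

theorem criticalExponent_nonneg {P : Set X} (hP : P.Nonempty) : 0 ≤ criticalExponent o P := by
  refine Monotone.expGrowthSup_nonneg (fun m n hmn => ?_) fun h => ?_
  · have hmn' : (m : ℝ) ≤ n := by exact_mod_cast hmn
    have := Set.encard_le_encard (Set.inter_subset_inter_left P
      (Metric.ball_subset_ball (x := o) hmn'))
    exact_mod_cast this
  · obtain ⟨x, hx⟩ := hP
    obtain ⟨n, hn⟩ := exists_nat_gt (dist x o)
    have h₁ := congrFun h n
    simp only [Pi.zero_apply] at h₁
    have h₂ : (Metric.ball o n ∩ P).encard = 0 := by exact_mod_cast h₁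
    exact (Set.encard_eq_zero.1 h₂).subset ⟨hn, hx⟩

/-- Each orbit point in the ball of radius `n` contributes at least `exp (-s * n)` to the series, so
there are at most `B * exp (s * n)` of them. -/
theorem criticalExponent_wordOrbit_le {s B : ℝ} (hs : 0 ≤ s)
    (hB : ∀ T : Finset (List ι), ∑ w ∈ T, Real.exp (-(s * wordNorm o g w)) ≤ B) :
    criticalExponent o (wordOrbit o g) ≤ (s : EReal) := by
  have htsum : ∑' w : List ι, ENNReal.ofReal (Real.exp (-(s * wordNorm o g w))) ≤
      ENNReal.ofReal B := by
    rw [ENNReal.tsum_eq_iSup_sum]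
    refine iSup_le fun T => ?_
    rw [← ENNReal.ofReal_sum_of_nonneg fun w _ => (Real.exp_pos _).le]
    exact ENNReal.ofReal_le_ofReal (hB T)
  rw [← ExpGrowth.expGrowthSup_exp (a := (s : EReal))]
  refine ExpGrowth.expGrowthSup_le_of_eventually_le (b := ENNReal.ofReal B)
    ENNReal.ofReal_ne_top (Eventually.of_forall fun n => ?_)
  have hexp : EReal.exp ((s : EReal) * (n : EReal)) = ENNReal.ofReal (Real.exp (s * n)) := by
    rw [← EReal.exp_coe]
    norm_cast
  have hw : ∀ x : ↥(Metric.ball o n ∩ wordOrbit o g), ∃ w : List ι, wordMap g w o = x := fun x =>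
    x.2.2.imp fun w hw => hw.2
  choose w hw using hw
  have hinj : Function.Injective w := fun x y hxy => Subtype.ext (by rw [← hw x, hxy, hw y])
  rw [hexp, ← ENNReal.tsum_set_one]
  calc ∑' _ : ↥(Metric.ball o n ∩ wordOrbit o g), (1 : ℝ≥0∞)
      ≤ ∑' x : ↥(Metric.ball o n ∩ wordOrbit o g),
          ENNReal.ofReal (Real.exp (-(s * wordNorm o g (w x)))) *
            ENNReal.ofReal (Real.exp (s * n)) := by
        refine ENNReal.tsum_le_tsum fun x => ?_
        rw [← ENNReal.ofReal_mul (Real.exp_pos _).le, ← Real.exp_add, ENNReal.one_le_ofReal,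
          Real.one_le_exp_iff]
        have : wordNorm o g (w x) ≤ n := by
          rw [wordNorm, hw]
          exact (Metric.mem_ball.1 x.2.1).le
        nlinarith
    _ ≤ (∑' w : List ι, ENNReal.ofReal (Real.exp (-(s * wordNorm o g w)))) *
            ENNReal.ofReal (Real.exp (s * n)) := by
        rw [ENNReal.tsum_mul_right]
        gcongr
        exact ENNReal.tsum_comp_le_tsum_of_injective hinj
          fun w => ENNReal.ofReal (Real.exp (-(s * wordNorm o g w)))
    _ ≤ ENNReal.ofReal B * ENNReal.ofReal (Real.exp (s * n)) := by gcongr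

theorem tsum_exp_ne_top_of_criticalExponent_lt {P : Set X} (hP : P.Nonempty) {s : ℝ}
    (h : criticalExponent o P < (s : EReal)) :
    ∑' x : P, ENNReal.ofReal (Real.exp (-(s * dist (x : X) o))) ≠ ∞ := by
  obtain ⟨t, hst, hts⟩ := EReal.lt_iff_exists_real_btwn.1 h
  have ht : 0 ≤ t := by
    exact_mod_cast ((criticalExponent_nonneg hP).trans_lt hst).le
  have hts' : t < s := by exact_mod_cast hts
  obtain ⟨N, hN⟩ := eventually_atTop.1 (ExpGrowth.eventually_le_exp hst)
  -- Enlarging the radius by `N` makes the eventual growth bound valid for every `n`, at the cost of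
  -- a constant factor.
  have hcard : ∀ n : ℕ, ((Metric.ball o ((n + 1 : ℕ) : ℝ) ∩ P).encard : ℝ≥0∞) ≤
      ENNReal.ofReal (Real.exp (t * (n + 1 + N : ℕ))) := fun n => by
    have h₁ := hN (n + 1 + N) (Nat.le_add_left _ _)
    rw [show (t : EReal) * ((n + 1 + N : ℕ) : EReal) = ((t * (n + 1 + N : ℕ) : ℝ) : EReal) by
      norm_cast, EReal.exp_coe] at h₁
    have h₂ : ((n + 1 : ℕ) : ℝ) ≤ (n + 1 + N : ℕ) := by exact_mod_cast Nat.le_add_right _ _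
    have h₃ := Set.encard_le_encard (Set.inter_subset_inter_left P
      (Metric.ball_subset_ball (x := o) h₂))
    refine le_trans ?_ h₁
    exact_mod_cast h₃
  have hle : ∑' x : P, ENNReal.ofReal (Real.exp (-(s * dist (x : X) o))) ≤
      ∑' n : ℕ, ENNReal.ofReal (Real.exp (t * (1 + N)) * Real.exp (t - s) ^ n) := by
    calc ∑' x : P, ENNReal.ofReal (Real.exp (-(s * dist (x : X) o)))
        ≤ ∑' x : P, ∑' n : ℕ, (Metric.ball o ((n + 1 : ℕ) : ℝ)).indicator
            (fun _ => ENNReal.ofReal (Real.exp (-(s * n)))) (x : X) := by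
          refine ENNReal.tsum_le_tsum fun x => ?_
          have hx := Nat.lt_floor_add_one (dist (x : X) o)
          have hx' := Nat.floor_le (dist_nonneg (x := (x : X)) (y := o))
          refine le_trans ?_ (ENNReal.le_tsum ⌊dist (x : X) o⌋₊)
          rw [Set.indicator_of_mem (by simpa using hx)]
          refine ENNReal.ofReal_le_ofReal (Real.exp_le_exp.2 ?_)
          nlinarith
      _ = ∑' n : ℕ, ENNReal.ofReal (Real.exp (-(s * n))) *
            ((Metric.ball o ((n + 1 : ℕ) : ℝ) ∩ P).encard : ℝ≥0∞) := by
          rw [ENNReal.tsum_comm]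
          refine tsum_congr fun n => ?_
          rw [← ENNReal.tsum_set_one, ← ENNReal.tsum_mul_left,
            tsum_subtype (Metric.ball o ((n + 1 : ℕ) : ℝ) ∩ P)
              (fun _ => ENNReal.ofReal (Real.exp (-(s * n))) * 1),
            tsum_subtype P (fun x => (Metric.ball o ((n + 1 : ℕ) : ℝ)).indicator
              (fun _ => ENNReal.ofReal (Real.exp (-(s * n)))) x),
            Set.indicator_indicator, Set.inter_comm]
          simp only [mul_one]
      _ ≤ ∑' n : ℕ, ENNReal.ofReal (Real.exp (t * (1 + N)) * Real.exp (t - s) ^ n) := by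
          refine ENNReal.tsum_le_tsum fun n => ?_
          refine (mul_le_mul_right (hcard n) _).trans_eq ?_
          rw [← ENNReal.ofReal_mul (Real.exp_pos _).le, ← Real.exp_add, ← Real.exp_nat_mul,
            ← Real.exp_add]
          congr 2
          push_cast
          ring
  refine ne_top_of_le_ne_top ?_ hle
  refine Summable.tsum_ofReal_ne_top ?_
  exact (summable_geometric_of_lt_one (Real.exp_pos _).le
    (Real.exp_lt_one_iff.2 (by linarith))).mul_left _

theorem SeparatedWords.infinite_wordOrbit [Nonempty ι] (h : SeparatedWords o g C) (R : ℝ) :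
    {x : wordOrbit o g | R ≤ dist (x : X) o}.Infinite := fun hfin => by
  obtain ⟨M, hM⟩ := (hfin.image fun x : wordOrbit o g => dist (x : X) o).bddAbove
  obtain ⟨n, hn⟩ := h.exists_length_le (max R M)
  obtain ⟨i⟩ := ‹Nonempty ι›
  have hlt := hn (List.replicate (n + 1) i) (by simp)
  have hmem : wordMap g (List.replicate (n + 1) i) o ∈ wordOrbit o g :=
    ⟨_, by simp, rfl⟩
  have hle := hM ⟨⟨_, hmem⟩, ((le_max_left _ _).trans_lt hlt).le, rfl⟩
  exact absurd hle (not_le.2 ((le_max_right _ _).trans_lt hlt))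

end CriticalExponent

/-! ### Comparison of the visual dimension with the critical exponent -/

section VisualDimension

variable {X : Type*} [MetricSpace X] [GromovHyperbolic X] {ι : Type*} {o : X} {g : ι → X ≃ᵢ X}
  {C δ : ℝ}

theorem exists_cover_of_visualMeasure_eq_zero {s : ℝ≥0} {Λ : Set (GromovBoundary o)}
    (h : visualMeasure s Λ = 0) {η : ℝ} (hη : 0 < η) :
    ∃ (ξ : ℕ → GromovBoundary o) (r : ℕ → ℝ), (∀ i, 0 < r i) ∧
      Λ ⊆ ⋃ i, boundaryBall (ξ i) (r i) ∧ ∀ J : Finset ℕ, ∑ i ∈ J, r i ^ (s : ℝ) < η := by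
  have h₁ : visualPremeasure s 1 Λ < ENNReal.ofReal η := by
    refine lt_of_le_of_lt ?_ (ENNReal.ofReal_pos.2 hη)
    rw [← h]
    exact le_iSup₂_of_le (1 : ℝ) one_pos le_rfl
  simp only [visualPremeasure, iInf_lt_iff] at h₁
  obtain ⟨ξ, r, hr, hcov, hsum⟩ := h₁
  refine ⟨ξ, r, fun i => (hr i).1, hcov, fun J => ?_⟩
  have h₂ := (ENNReal.sum_le_tsum J).trans_lt hsum
  rw [← ENNReal.ofReal_sum_of_nonneg fun i _ => Real.rpow_nonneg (hr i).1.le _] at h₂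
  exact (ENNReal.ofReal_lt_ofReal_iff hη).1 h₂

namespace SeparatedWords

theorem criticalExponent_le_of_visualMeasure_eq_zero [Finite ι] [Nonempty ι]
    (h : SeparatedWords o g C) {s : ℝ≥0}
    (hs : visualMeasure s (boundaryOf o (wordOrbit o g)) = 0) :
    criticalExponent o (wordOrbit o g) ≤ ((s : ℝ) : EReal) := by
  classical
  obtain ⟨δ, -, hδ⟩ := GromovHyperbolic.exists_delta (X := X)
  have hs₀ : (0 : ℝ) ≤ s := s.2
  set f : List ι → ℝ := fun w => Real.exp (-(s * wordNorm o g w)) with hf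
  have hf₀ : ∀ w, 0 ≤ f w := fun w => (Real.exp_pos _).le
  set K := Real.exp (2 * C * s) with hK
  have hK₁ : 1 ≤ K := Real.one_le_exp_iff.2 (by have := h.nonneg; positivity)
  have hmul : ∀ u v, f (u ++ v) ≤ K * (f u * f v) := fun u v => by
    rw [hf, hK, ← Real.exp_add, ← Real.exp_add]
    refine Real.exp_le_exp.2 ?_
    have := mul_le_mul_of_nonneg_left (h.le_wordNorm_append u v) hs₀
    linarith
  set E := Real.exp (s * (C + 3 * δ)) with hE
  have hE₀ : 0 < E := Real.exp_pos _
  -- `K` pays for concatenation and `E` for the passage from radii to word norms; this bound makes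
  -- the total weight, times `K`, at most `1 / 2`.
  obtain ⟨ξ, r, hr, hcov, hsum⟩ := exists_cover_of_visualMeasure_eq_zero hs
    (η := 1 / (2 * K * E)) (by positivity)
  choose w hw using fun i => h.exists_word_of_boundaryBall (hδ o) (ξ i) (r i)
  obtain ⟨J, hJ, hJcov⟩ := exists_finite_subcover_wordPrefix
    (I := {i | ∃ u, h.limitPoint u ∈ boundaryBall (ξ i) (r i)}) (w := w) fun u => by
      obtain ⟨i, hi⟩ := Set.mem_iUnion.1 (hcov (h.limitPoint_mem u))
      exact ⟨i, ⟨u, hi⟩, (hw i u hi).2⟩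
  have hfr : ∀ i ∈ J, f (w i) ≤ E * r i ^ (s : ℝ) := fun i hi => by
    obtain ⟨u, hu⟩ := hJ i hi
    rw [hf, hE, Real.rpow_def_of_pos (hr i), ← Real.exp_add]
    refine Real.exp_le_exp.2 ?_
    have := mul_le_mul_of_nonneg_left (hw i u hu).1 hs₀
    linarith
  have hsumF : K * ∑ v ∈ J.image w, f v ≤ 1 / 2 := by
    have h₁ : ∑ v ∈ J.image w, f v ≤ E * ∑ i ∈ J, r i ^ (s : ℝ) := by
      rw [Finset.mul_sum]
      exact (Finset.sum_image_le_of_nonneg fun i _ => hf₀ _).trans (Finset.sum_le_sum hfr)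
    calc K * ∑ v ∈ J.image w, f v ≤ K * (E * (1 / (2 * K * E))) := by
          gcongr
          exact h₁.trans (by gcongr; exact (hsum J).le)
      _ = 1 / 2 := by field_simp
  -- The empty word has weight 1, too much for a total of at most `1 / 2`.
  have hnil : [] ∉ J.image w := fun hmem => by
    have h₁ := Finset.single_le_sum (fun v _ => hf₀ v) hmem
    have h₂ : f [] = 1 := by simp [hf]
    nlinarith
  obtain ⟨B, hB⟩ := exists_sum_le_of_wordPrefix hf₀ hmul hnil (fun u => by
    obtain ⟨i, hi, hu⟩ := hJcov u
    exact ⟨w i, Finset.mem_image_of_mem _ hi, hu⟩) hsumF one_half_lt_one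
  exact criticalExponent_wordOrbit_le hs₀ hB

/-- The point `x` is a prefix, of fixed length, of a word for a far term of a sequence tending to
`ξ`. Any word for `x` will do, as only norms and orbit points enter, so one choice of ball per orbit
point suffices. -/
theorem exists_orbit_point_mem_boundaryBall [Finite ι] (h : SeparatedWords o g C)
    (hδ : ∀ x y z : X, min (gromovProd o x y) (gromovProd o y z) - δ ≤ gromovProd o x z)
    {ξ : GromovBoundary o} (hξ : ξ ∈ boundaryOf o (wordOrbit o g)) (R : ℝ) :
    ∃ x ∈ wordOrbit o g, R ≤ dist x o ∧ ∀ (w : List ι) (u : ℕ → ι), wordMap g w o = x →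
      wordPrefix u w.length = w →
      ξ ∈ boundaryBall (h.limitPoint u) (Real.exp (-(dist x o - (C + 2 * δ + 1)))) := by
  obtain ⟨z, hz, rfl⟩ := hξ
  obtain ⟨n, hn⟩ := h.exists_length_le R
  obtain ⟨M, hM⟩ := ((List.finite_length_le ι (n + 1)).image (wordNorm o g)).bddAbove
  replace hM : ∀ w : List ι, w.length ≤ n + 1 → wordNorm o g w ≤ M := fun w hw => hM ⟨w, hw, rfl⟩
  -- The tail products exceed the norm of every word of length at most `n + 1`, so the term `z k`
  -- needs a longer word and its prefix also shadows the later terms.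
  obtain ⟨k, hk⟩ := gromovClose_iff.1 z.2 (M + 1)
  obtain ⟨w, hw, hwz⟩ := hz k
  have hlen : n + 1 < w.length := by
    by_contra! hle
    have h₁ := hk k k le_rfl le_rfl
    have h₂ := hM w hle
    rw [gromovProd_self, ← hwz] at h₁
    unfold wordNorm at h₂
    linarith
  have hlen' : (w.take (n + 1)).length = n + 1 := by simp [hlen.le]
  have hle := hM _ hlen'.le
  refine ⟨wordMap g (w.take (n + 1)) o, ⟨_, fun h => by simp [h] at hlen', rfl⟩,
    (hn _ (by omega)).le, fun v u hv huv => ?_⟩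
  change wordNorm o g _ ≤ M at hle
  set a := wordNorm o g (w.take (n + 1)) with ha
  change _ ∈ boundaryBall _ (Real.exp (-(a - (C + 2 * δ + 1))))
  have hva : wordNorm o g v = a := by rw [wordNorm, hv, ha, wordNorm]
  change ((-Real.log (Real.exp (-(a - (C + 2 * δ + 1)))) : ℝ) : EReal) < _
  rw [Real.log_exp, neg_neg]
  refine lt_of_lt_of_le ?_ (le_boundaryProd (h.wordSeq u) z (a := a - C - 2 * δ)
    (k := max k v.length) fun i j hi hj => ?_)
  · exact_mod_cast (by linarith : a - (C + 2 * δ + 1) < a - C - 2 * δ)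
  have h₁ : a - C ≤ gromovProd o (z.1 k) (wordMap g (w.take (n + 1)) o) := by
    have := h.le_prod_append (w.take (n + 1)) (w.drop (n + 1))
    rwa [List.take_append_drop, hwz] at this
  have h₂ : a - C ≤ gromovProd o (z.1 k) (z.1 j) := by
    have := hk k j le_rfl ((le_max_left _ _).trans hj)
    have := h.nonneg
    linarith
  rw [gromovProd_comm] at h₁
  have h₃ := le_gromovProd_of_le_of_le hδ h₁ h₂
  have h₄ : a - C ≤ gromovProd o ((h.wordSeq u).1 i) (wordMap g (w.take (n + 1)) o) := by
    obtain ⟨b, hb⟩ := exists_wordPrefix_eq_append u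
      (((le_max_right _ _).trans hi).trans i.le_succ)
    rw [huv] at hb
    have := h.le_prod_append v b
    rw [← hb, hv, hva] at this
    exact this
  have hδ₀ : 0 ≤ δ := by
    have := hδ o o o
    simp [gromovProd] at this
    linarith
  have := le_gromovProd_of_le_of_le hδ (le_trans (by linarith) h₄) h₃
  linarith

theorem visualMeasure_eq_zero_of_criticalExponent_lt [Finite ι] [Nonempty ι]
    (h : SeparatedWords o g C) {s : ℝ≥0}
    (hs : criticalExponent o (wordOrbit o g) < ((s : ℝ) : EReal)) :
    visualMeasure s (boundaryOf o (wordOrbit o g)) = 0 := by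
  obtain ⟨δ, -, hδ⟩ := GromovHyperbolic.exists_delta (X := X)
  set D := C + 2 * δ + 1 with hD
  have hne : (wordOrbit o g).Nonempty := by
    obtain ⟨x, -⟩ := (h.infinite_wordOrbit 0).nonempty
    exact ⟨x, x.2⟩
  have : Countable (wordOrbit o g) :=
    Set.Countable.mono (s₁ := wordOrbit o g) (fun x hx => hx.imp fun w hw => hw.2)
      (Set.countable_range fun w : List ι => wordMap g w o)
  have hu : ∀ x : wordOrbit o g, ∃ (u : ℕ → ι) (w : List ι), wordMap g w o = x ∧
      wordPrefix u w.length = w := fun x => by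
    obtain ⟨w, -, hw⟩ := x.2
    obtain ⟨u, hu⟩ := exists_infinite_word w
    exact ⟨u, w, hw, hu⟩
  choose u v hv huv using hu
  set φ : wordOrbit o g → ℝ≥0∞ := fun x =>
    ENNReal.ofReal (Real.exp (-(dist (x : X) o - D)) ^ (s : ℝ)) with hφ
  have hsum : ∑' x, φ x ≠ ∞ := by
    have h₁ : ∀ x, φ x = ENNReal.ofReal (Real.exp (s * D)) *
        ENNReal.ofReal (Real.exp (-(s * dist (x : X) o))) := fun x => by
      rw [hφ, ← ENNReal.ofReal_mul (Real.exp_pos _).le, ← Real.exp_add]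
      simp only
      rw [← Real.exp_mul]
      congr 2
      ring
    simp_rw [h₁]
    rw [ENNReal.tsum_mul_left]
    exact ENNReal.mul_ne_top ENNReal.ofReal_ne_top (tsum_exp_ne_top_of_criticalExponent_lt hne hs)
  simp only [visualMeasure, ENNReal.iSup_eq_zero]
  intro ε hε
  refine le_antisymm (le_of_forall_gt_imp_ge_of_dense fun η hη => ?_) bot_le
  obtain ⟨t, ht⟩ := ((ENNReal.tendsto_tsum_compl_atTop_zero hsum).eventually_lt_const hη).exists
  obtain ⟨M, hM⟩ := (t.finite_toSet.image fun x : wordOrbit o g => dist (x : X) o).bddAbove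
  -- Beyond `M + 1` the orbit points avoid the finite set `t`; beyond `D - log ε` the radii are at
  -- most `ε`.
  set R := max (M + 1) (D - Real.log ε) with hR
  -- Infinitude lets the family of balls be enumerated by `ℕ` bijectively, with no padding.
  have : Infinite {x : wordOrbit o g | R ≤ dist (x : X) o} := (h.infinite_wordOrbit R).to_subtype
  obtain ⟨e⟩ := nonempty_equiv_of_countable (α := ℕ) (β := {x : wordOrbit o g | R ≤ dist (x : X) o})
  refine (iInf₂_le_of_le (fun n => h.limitPoint (u (e n)))
    (fun n => Real.exp (-(dist ((e n : wordOrbit o g) : X) o - D)))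
    (iInf₂_le_of_le (fun n => ⟨Real.exp_pos _, ?_⟩) (fun ξ hξ => ?_) le_rfl)).trans
      (le_trans ?_ ht.le)
  rotate_right
  · show Real.exp (-(dist ((e n : wordOrbit o g) : X) o - D)) ≤ ε
    rw [← Real.le_log_iff_exp_le hε]
    have h₁ : R ≤ dist ((e n : wordOrbit o g) : X) o := (e n).2
    have := (le_max_right (M + 1) (D - Real.log ε)).trans h₁
    linarith
  · obtain ⟨x, hx, hxR, hmem⟩ := h.exists_orbit_point_mem_boundaryBall (hδ o) hξ R
    refine Set.mem_iUnion.2 ⟨e.symm ⟨⟨x, hx⟩, hxR⟩, ?_⟩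
    simp only [Equiv.apply_symm_apply]
    exact hmem _ _ (hv ⟨x, hx⟩) (huv ⟨x, hx⟩)
  · have hinj : ∀ x : {x : wordOrbit o g | R ≤ dist (x : X) o}, (x : wordOrbit o g) ∉ t :=
      fun x hx => by
        have h₁ := hM ⟨x, hx, rfl⟩
        have h₂ : R ≤ dist ((x : wordOrbit o g) : X) o := x.2
        have := (le_max_left (M + 1) (D - Real.log ε)).trans h₂
        simp only at h₁
        linarith
    refine (e.tsum_eq fun x => φ x).trans_le ?_
    exact ENNReal.tsum_comp_le_tsum_of_injective
      (f := fun x : {x : wordOrbit o g | R ≤ dist (x : X) o} => (⟨x, hinj x⟩ : {x // x ∉ t}))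
      (fun x y hxy => Subtype.ext (Subtype.mk.inj hxy)) fun x => φ x

theorem visualDim_eq_criticalExponent [Finite ι] [Nonempty ι] (h : SeparatedWords o g C) :
    visualDim (boundaryOf o (wordOrbit o g)) = criticalExponent o (wordOrbit o g) := by
  have hne : (wordOrbit o g).Nonempty := by
    obtain ⟨x, -⟩ := (h.infinite_wordOrbit 0).nonempty
    exact ⟨x, x.2⟩
  refine le_antisymm (EReal.le_of_forall_lt_iff_le.1 fun s hs => ?_)
    (le_iInf₂ fun s hs => h.criticalExponent_le_of_visualMeasure_eq_zero hs)
  have hs₀ : 0 ≤ s := by exact_mod_cast ((criticalExponent_nonneg hne).trans_lt hs).le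
  exact iInf₂_le (⟨s, hs₀⟩ : ℝ≥0) (h.visualMeasure_eq_zero_of_criticalExponent_lt (s := ⟨s, hs₀⟩) hs)

end SeparatedWords

end VisualDimension

theorem mainTheorem9 {X : Type*} [MetricSpace X] [ProperSpace X] [GromovHyperbolic X] (o : X)
    (hX : CompactSpace (GromovBoundary o)) (Γ : Subsemigroup (X ≃ᵢ X)) (hΓ : IsSchottky o Γ) :
    visualDim (limitSet o Γ) = criticalExponent o (orbitOf o (Γ : Set (X ≃ᵢ X))) := by
  obtain ⟨S, C, hS, horbit, h⟩ := hΓ.exists_separatedWords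
  have : Nonempty S := hS.to_subtype
  rw [limitSet, horbit]
  exact h.visualDim_eq_criticalExponent
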